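/- **Setting.** Let $D\in\mathbb N$, $\mathcal X=[-1,1]^D$ and $f:\mathcal X\to\mathbb R$ (measurable). A *sparse embedding matrix* is a matrix $S\in\{0,\pm1\}^{d\times D}$ each of whose columns has exactly one non-zero entry; the *bin* of the target dimension $j\le d$ is the set of input dimensions $i$ with $S_{ji}\ne0$. The function $f$ is *sparse* if for some $1\le d_e\le D$ there is a sparse embedding matrix $S\in\{0,\pm1\}^{d_e\times D}$ such that every $x\in\mathcal X$ has a $z\in[-1,1]^{d_e}$ with $f(x)=f(S^{\intercal}z)$, where $d_e$ is the smallest integer with this property. **Algorithm (BAxUS).** Parameters: number of new bins $b\ge1$; initial target dimensionality $1\le d_{\rm init}\le D$; $m_D\in\mathbb N$; number of initial points $n_{\rm init}\ge1$; success tolerance $\tau_{\rm success}\ge1$; base side lengths $0<L_{\min}<L_{\rm init}\le L_{\max}$; improvement threshold $\gamma>0$. The algorithm has a target dimensionality $d$, a sparse embedding $S\in\{0,\pm1\}^{d\times D}$, a list of observations $(y,f(S^{\intercal}y))$ with $y\in[-1,1]^d$, and a base side length $L$. It starts with $d=d_{\rm init}$, a random embedding with bins of sizes $\lceil D/d\rceil$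 or $\lfloor D/d\rfloor$, no observations, and $L=L_{\rm init}$. Function values are observed without noise, and the evaluation budget is unlimited. 1. While there are fewer than $n_{\rm init}$ observations, evaluate $f(S^{\intercal}y)$ at some $y\in[-1,1]^d$ and add the observation. 2. Otherwise choose $y\in[-1,1]^d$ in the trust region, the hyper-rectangle centred at a best observed point whose $i$-th side length is $L\,\ell_i/(\prod_{j}\ell_j)^{1/d}$ for some length scales $\ell_1,\dots,\ell_d>0$. Evaluate $f(S^{\intercal}y)$ and add the observation. The evaluation is a success if it improves on the best current observation by at least $\gamma$, and a failure otherwise. After $\tau_{\rm success}$ consecutive successes, $L$ becomes $\min(2L,L_{\max})$; after $\tau_{\rm fail}=\max\bigl(1,\min(\lfloor m^s/k\rfloor,d)\bigr)$ consecutive failures, $L$ is halved. Here $k=\lfloor\log_{1/2}(L_{\min}/L_{\rm init})\rfloor$ (if $k=0$, put $\tau_{\rm fail}=1$), $m^s$ is $\frac{b\,m_D\,d}{d_{\rm init}((b+1)^{n+1}-1)}$ rounded to the nearest integer, and $n$ is $\log_{b+1}(D/d_{\rm init})$ rounded to the nearest integer. Either change of $L$ resets the counters. 3. When $L\le L_{\min}$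 and $d<D$, the target dimensionality becomes $\min(d(b+1),D)$: each bin with $l$ elements is split, evenly up to one element and keeping the signs, into itself and $\min(b,l-1)$ new bins; the observations are kept by copying coordinates to the new target dimensions; $L$ and the counters are reset. When $L\le L_{\min}$ and $d=D$, the algorithm *restarts*: all observations are discarded, $L$ and the counters are reset, and $n_{\rm init}$ new initial points are evaluated as in step 1. The length scales and the choice of $y$ in step 2 (and the random choices elsewhere, apart from (A5)) are arbitrary; in particular they may come from Thompson sampling with a fitted Gaussian process. Let $x_0,x_1,\dots$ be the (random) points of $\mathcal X$ at which $f$ is successively evaluated, assumed measurable. **Theorem (BAxUS consistency).** Assume: * (A1) $D$ is finite; * (A2) $f$ is observed without noise; * (A3) $f$ is sparse, and bounded on $\mathcal X$: there is $C>0$ with $|f(x)|<C$ for all $x\in\mathcal X$; * (A4) at least one minimizer of $f$ over $\mathcal X$ lies in a region $R\subseteq\mathcal X$ of positive Lebesgue measure on which $f$ is continuous, where a region is a set contained in the closure of its interior (an open set together with some, none or all of its boundary points); * (A5) for all $x\in\mathcal X$ and $\delta>0$ there is $\nu(x,\delta)>0$ such that, at each restart in the input dimension $D$, conditionally on the points evaluated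 before this restart, the probability that at least one of the $n_{\rm init}$ initial points of the restart lies within Euclidean distance $\delta$ of $x$ is at least $\nu(x,\delta)$. Let $x'_k\in\arg\min_{x\in\{x_0,\dots,x_k\}}f(x)$ be a best point among those evaluated so far, and let $x^*\in\arg\min_{x\in\mathcal X}f(x)$. Then $f(x'_k)\to f(x^*)$ as $k\to\infty$ with probability $1$. -/

import Mathlib

open MeasureTheory Filter Topology

namespace Baxus

open scoped Classical Matrix

noncomputable section

/-- Points of `ℝᵈ`, with the Euclidean norm. -/
abbrev Pt (d : ℕ) : Type := EuclideanSpace ℝ (Fin d)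

/-- The box `[-1, 1]ᵈ`: the input space `𝒳` for `d = D`, the target space `𝒴` for smaller `d`. -/
def cube (d : ℕ) : Set (Pt d) := {x | ∀ i, x i ∈ Set.Icc (-1 : ℝ) 1}

/-! ### Sparse embeddings -/

/-- A sparse embedding matrix `S ∈ {0, ±1}^{d × D}`: every column has exactly one non-zero entry. -/
def IsSparseEmbedding {d D : ℕ} (S : Matrix (Fin d) (Fin D) ℝ) : Prop :=
  (∀ j i, S j i = 0 ∨ S j i = 1 ∨ S j i = -1) ∧ ∀ i, ∃! j, S j i ≠ 0

/-- The map `y ↦ Sᵀ y` from the target space to the input space. -/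
def lift {d D : ℕ} (S : Matrix (Fin d) (Fin D) ℝ) (y : Pt d) : Pt D :=
  WithLp.toLp 2 (Sᵀ *ᵥ y.ofLp)

/-- The bin of the target dimension `j`: the input dimensions that contribute to it. -/
def bin {d D : ℕ} (S : Matrix (Fin d) (Fin D) ℝ) (j : Fin d) : Finset (Fin D) :=
  Finset.univ.filter fun i => S j i ≠ 0

/-- The possible values of the random BAxUS embedding of `D` input dimensions into `d` bins:
the signs and the assignment are arbitrary, but the `i`-th bin (counted from one) has `⌈D/d⌉`
elements if `i + d ⌊D/d⌋ ≤ D`, and `⌊D/d⌋` elements otherwise. -/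
def IsBaxusEmbedding {d D : ℕ} (S : Matrix (Fin d) (Fin D) ℝ) : Prop :=
  IsSparseEmbedding S ∧
    ∀ j : Fin d, (bin S j).card = if (j : ℕ) + 1 + d * (D / d) ≤ D then D ⌈/⌉ d else D / d

/-- The possible results `S'` of the observation-preserving increase of the embedding `S`.
`parent j` is the target dimension that was split to create the target dimension `j`.
* The old target dimensions keep their position, and the new ones are appended at the end,
  in the order of the dimensions that they come from.
* A bin with `l` elements is split into itself and `min b (l - 1)` new bins.
* Each contributing input dimension moves to one of the bins split off from its old bin
  and keeps its sign.
* The sizes of the bins that come from the same bin differ by at most one. -/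
def IsRefinement {d d' D : ℕ} (b : ℕ) (S : Matrix (Fin d) (Fin D) ℝ)
    (S' : Matrix (Fin d') (Fin D) ℝ) (parent : Fin d' → Fin d) : Prop :=
  IsSparseEmbedding S' ∧
  (∀ j : Fin d', (j : ℕ) < d → (parent j : ℕ) = j) ∧
  (∀ j j' : Fin d', d ≤ (j : ℕ) → j ≤ j' → parent j ≤ parent j') ∧
  (∀ s : Fin d, (Finset.univ.filter fun j => parent j = s).card =
    min b ((bin S s).card - 1) + 1) ∧
  (∀ j i, S' j i ≠ 0 → S' j i = S (parent j) i) ∧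
  (∀ j j' : Fin d', parent j = parent j' → (bin S' j).card ≤ (bin S' j').card + 1)

/-! ### The objective -/

/-- `f` can be represented on `[-1, 1]^dₑ` through a sparse embedding matrix. -/
def HasSparseSubspace {D : ℕ} (f : Pt D → ℝ) (dₑ : ℕ) : Prop :=
  ∃ S : Matrix (Fin dₑ) (Fin D) ℝ, IsSparseEmbedding S ∧
    ∀ x ∈ cube D, ∃ z ∈ cube dₑ, f x = f (lift S z)

/-- `f` is sparse, with effective dimensionality `dₑ`, the smallest possible one. -/
def IsSparse {D : ℕ} (f : Pt D → ℝ) : Prop :=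
  ∃ dₑ : ℕ, 1 ≤ dₑ ∧ dₑ ≤ D ∧ HasSparseSubspace f dₑ ∧
    ∀ d : ℕ, 1 ≤ d → HasSparseSubspace f d → dₑ ≤ d

/-- `x` is a global minimizer of `f` in `𝒳`. -/
def IsMinimizer {D : ℕ} (f : Pt D → ℝ) (x : Pt D) : Prop :=
  x ∈ cube D ∧ ∀ z ∈ cube D, f x ≤ f z

/-- `x` lies in a region `R ⊆ 𝒳` of positive measure on which `f` is continuous. A region is
an open set together with some, none or all of its boundary points. -/
def InContinuousRegion {D : ℕ} (f : Pt D → ℝ) (x : Pt D) : Prop :=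
  ∃ R : Set (Pt D), R ⊆ cube D ∧ x ∈ R ∧ R ⊆ closure (interior R) ∧ 0 < volume R ∧
    ContinuousOn f R

/-! ### The algorithm -/

/-- The inputs and the hyperparameters of BAxUS in input dimension `D`. -/
structure Params (D : ℕ) where
  /-- number of new bins per split -/
  b : ℕ
  /-- initial target dimensionality -/
  dInit : ℕ
  /-- number of evaluations by which the input dimension should be reached -/
  mD : ℕ
  /-- number of initial points of a trust region that starts from scratch -/
  nInit : ℕ
  /-- number of consecutive successes after which the trust region is expanded -/
  succTol : ℕ
  /-- initial, minimum and maximum base side length of the trust region -/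
  lenInit : ℝ
  lenMin : ℝ
  lenMax : ℝ
  /-- a point is an improvement if it improves on the current best by at least `γ` -/
  γ : ℝ
  one_le_b : 1 ≤ b
  one_le_dInit : 1 ≤ dInit
  dInit_le : dInit ≤ D
  one_le_nInit : 1 ≤ nInit
  one_le_succTol : 1 ≤ succTol
  lenMin_pos : 0 < lenMin
  lenMin_lt : lenMin < lenInit
  lenInit_le : lenInit ≤ lenMax
  γ_pos : 0 < γ

namespace Params

variable {D : ℕ} (P : Params D)

/-- The number of splits, `log_{b+1} (D / d_init)` rounded to the nearest integer. -/
def numSplits : ℕ := (round (Real.logb (P.b + 1) (D / P.dInit))).toNat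

/-- The split budget `b m_D d / (d_init ((b+1)^{n+1} - 1))` of the target dimensionality `d`,
rounded to the nearest integer. -/
def splitBudget (d : ℕ) : ℕ :=
  (round ((P.b * P.mD * d : ℝ) / (P.dInit * ((P.b + 1 : ℝ) ^ (P.numSplits + 1) - 1)))).toNat

/-- The number of times the base side length has to be halved to get below the minimum. -/
def numHalvings : ℕ := ⌊Real.logb (1 / 2) (P.lenMin / P.lenInit)⌋₊

/-- The number of accepted failures in target dimensionality `d`. -/
def failTol (d : ℕ) : ℕ := max 1 (min (P.splitBudget d / P.numHalvings) d)

end Params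

/-- The state of the algorithm between two function evaluations. -/
structure State (D : ℕ) where
  /-- current target dimensionality -/
  dim : ℕ
  /-- current embedding -/
  emb : Matrix (Fin dim) (Fin D) ℝ
  /-- the observations `(y, f (Sᵀ y))` in use, in order of evaluation -/
  data : List (Pt dim × ℝ)
  /-- base side length of the trust region -/
  len : ℝ
  /-- number of consecutive successes -/
  succ : ℕ
  /-- number of consecutive failures -/
  fail : ℕ

/-- Add an observation to the data. -/
def record {D : ℕ} (s : State D) (y : Pt s.dim) (v : ℝ) : State D :=
  ⟨s.dim, s.emb, s.data ++ [(y, v)], s.len, s.succ, s.fail⟩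

/-- `v` improves by at least `γ` over all observations in use. -/
def Improves {D : ℕ} (P : Params D) (s : State D) (v : ℝ) : Prop :=
  ∀ q ∈ s.data, v ≤ q.2 - P.γ

/-- Add an observation to the data and adjust the trust region: it doubles, up to the maximum,
after `succTol` consecutive successes and halves after `failTol` consecutive failures. -/
def adjust {D : ℕ} (P : Params D) (s : State D) (y : Pt s.dim) (v : ℝ) : State D :=
  if Improves P s v then
    if P.succTol ≤ s.succ + 1 then
      ⟨s.dim, s.emb, s.data ++ [(y, v)], min (2 * s.len) P.lenMax, 0, 0⟩
    else
      ⟨s.dim, s.emb, s.data ++ [(y, v)], s.len, s.succ + 1, 0⟩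
  else
    if P.failTol s.dim ≤ s.fail + 1 then
      ⟨s.dim, s.emb, s.data ++ [(y, v)], s.len / 2, 0, 0⟩
    else
      ⟨s.dim, s.emb, s.data ++ [(y, v)], s.len, 0, s.fail + 1⟩

/-- The trust region with center `c` and base side length `L`, for the length scales `ℓ`: the side
lengths are proportional to the length scales, and their geometric mean is `L`. -/
def trustRegion {d : ℕ} (c : Pt d) (ℓ : Fin d → ℝ) (L : ℝ) : Set (Pt d) :=
  {y | y ∈ cube d ∧ ∀ i, |y i - c i| ≤ L * (ℓ i / (∏ j, ℓ j) ^ (1 / (d : ℝ))) / 2}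

/-- `c` is a best point among the observations in use. -/
def IsCenter {D : ℕ} (s : State D) (c : Pt s.dim) : Prop :=
  ∃ v : ℝ, (c, v) ∈ s.data ∧ ∀ q ∈ s.data, v ≤ q.2

/-- `s'` results from `s` by increasing the target dimensionality. The observations are kept: the
coordinates are copied to the new target dimensions. The trust region is reset. -/
def IsSplit {D : ℕ} (P : Params D) (s s' : State D) : Prop :=
  s'.dim = min (s.dim * (P.b + 1)) D ∧
  (∃ parent : Fin s'.dim → Fin s.dim,
    IsRefinement P.b s.emb s'.emb parent ∧
    s'.data = s.data.map fun q => (WithLp.toLp 2 fun j => q.1 (parent j), q.2)) ∧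
  s'.len = P.lenInit ∧ s'.succ = 0 ∧ s'.fail = 0

/-- Restart in the input dimension: all observations are discarded, so that new initial points
are sampled next, and the trust region is reset. -/
def restart {D : ℕ} (P : Params D) (s : State D) : State D :=
  ⟨s.dim, s.emb, [], P.lenInit, 0, 0⟩

/-- What happens after the trust region has been adjusted. -/
def Continue {D : ℕ} (P : Params D) (s s' : State D) : Prop :=
  if P.lenMin < s.len then s' = s
  else if s.dim < D then IsSplit P s s'
  else s' = restart P s

/-- One noiseless function evaluation, at the point `x = Sᵀ y`, takes the state `s` to `s'`.
As long as initial points are missing, `y` is any point of the target space. Afterwards, `y` is a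
point of the trust region around a current best point, for some positive length scales.
The surrogate model enters the algorithm only through the length scales and through the
choice of `y` in the trust region, and both are left arbitrary here: Thompson sampling from a
fitted Gaussian process is covered, whatever the kernel, the candidate set and the fit. -/
def Step {D : ℕ} (P : Params D) (f : Pt D → ℝ) (s : State D) (x : Pt D) (s' : State D) : Prop :=
  ∃ y ∈ cube s.dim, x = lift s.emb y ∧
    if s.data.length < P.nInit then s' = record s y (f x)
    else
      (∃ (c : Pt s.dim) (ℓ : Fin s.dim → ℝ), IsCenter s c ∧ (∀ i, 0 < ℓ i) ∧
        y ∈ trustRegion c ℓ s.len) ∧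
      Continue P (adjust P s y (f x)) s'

/-- The state before the first evaluation. -/
def IsInitial {D : ℕ} (P : Params D) (s : State D) : Prop :=
  s.dim = P.dInit ∧ IsBaxusEmbedding s.emb ∧ s.data = [] ∧ s.len = P.lenInit ∧
    s.succ = 0 ∧ s.fail = 0

/-- A (random) run of BAxUS with unlimited budget: `x k` is the `k`-th point at which `f` is
evaluated, `k = 0, 1, …`, and `state k` is the state of the algorithm right before that. -/
structure IsRun {D : ℕ} (P : Params D) (f : Pt D → ℝ) {Ω : Type*} [MeasurableSpace Ω]
    (state : ℕ → Ω → State D) (x : ℕ → Ω → Pt D) : Prop where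
  measurable : ∀ k, Measurable (x k)
  initial : ∀ ω, IsInitial P (state 0 ω)
  step : ∀ k ω, Step P f (state k ω) (x k ω) (state (k + 1) ω)

/-- The event that the algorithm has restarted in the input dimension right before the
evaluation `k`, so that `x k, …, x (k + nInit - 1)` are the initial points of this restart. -/
def restartAt {D : ℕ} {Ω : Type*} (state : ℕ → Ω → State D) (k : ℕ) : Set Ω :=
  {ω | 0 < k ∧ (state k ω).dim = D ∧ (state k ω).data = []}

/-- The information in the evaluations before the evaluation `k`. -/
abbrev history {D : ℕ} {Ω : Type*} (x : ℕ → Ω → Pt D) (k : ℕ) : MeasurableSpace Ω :=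
  ⨆ j, ⨆ _ : j < k, MeasurableSpace.comap (x j) inferInstance

/-- For every ball with center `p ∈ 𝒳` and radius `δ` there is `ν > 0` such that, at each restart
in the input dimension, at least one of the initial points falls into the ball with
probability at least `ν`, conditionally on the evaluations before the restart. -/
def RestartsHitBalls {D : ℕ} (P : Params D) {Ω : Type*} [MeasurableSpace Ω] (μ : Measure Ω)
    (state : ℕ → Ω → State D) (x : ℕ → Ω → Pt D) : Prop :=
  ∀ p ∈ cube D, ∀ δ : ℝ, 0 < δ → ∃ ν : ℝ, 0 < ν ∧
    ∀ (k : ℕ) (A : Set Ω), MeasurableSet[history x k] A → A ⊆ restartAt state k →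
      ENNReal.ofReal ν * μ A ≤ μ (A ∩ {ω | ∃ i < P.nInit, ‖p - x (k + i) ω‖ ≤ δ})

/-- `xbest k` is a best one among the evaluated points `x 0, …, x k`. -/
def IsBestSoFar {D : ℕ} (f : Pt D → ℝ) {Ω : Type*} (x xbest : ℕ → Ω → Pt D) : Prop :=
  ∀ k ω, (∃ j ≤ k, xbest k ω = x j ω) ∧ ∀ j ≤ k, f (xbest k ω) ≤ f (x j ω)

end

end Baxus

namespace Baxus

open scoped Classical

noncomputable section

/-! The control flow depends on the observed values alone: dimension, number and minimum of the
observations in use, side length and counters form a `Summary` that evolves deterministically by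
`Summary.run`. This has two consequences. First, a restart is an event of `history`, so the hitting
hypothesis applies to it (`IsRun.measurableSet_restartAt`). Second, since `f` is bounded below,
every path restarts infinitely often: a well-founded potential drops at each evaluation that does
not lead to a restart (`potential_next_lt`).

Fix a ball centred in the box, and let `G k` be the event of a restart at `k` with the ball not hit
before. Given `G k`, the initial points hit the ball with probability at least `ν`. For different
`k` these hits are disjoint events, so `ν * ∑ μ (G k) ≤ 1`, and by Borel–Cantelli almost surely only
finitely many `G k` occur. A path that never hits the ball would lie in infinitely many of them, so
almost surely the ball is hit (`IsRun.ae_exists_mem_closedBall`).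

By continuity, for each `n` some ball has all values below the minimum plus `1 / (n + 1)`. Almost
surely all these balls are hit, and the best value never increases. -/

/-- The part of a state that is determined by the observed values. -/
structure Summary where
  /-- target dimensionality -/
  dim : ℕ
  /-- number of observations in use -/
  count : ℕ
  /-- least observed value in use, if there is one -/
  best : ℝ
  /-- base side length -/
  len : ℝ
  /-- number of consecutive successes -/
  succ : ℕ
  /-- number of consecutive failures -/
  fail : ℕ

/-! ### Deterministic dynamics of the summaries -/

namespace Summary

variable {D : ℕ} (P : Params D)

/-- The summary after a further initial point with value `v`. -/
def record (t : Summary) (v : ℝ) : Summary :=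
  ⟨t.dim, t.count + 1, if t.count = 0 then v else min t.best v, t.len, t.succ, t.fail⟩

/-- The summary after an observation in the trust region and the adjustment of its size. -/
def adjust (t : Summary) (v : ℝ) : Summary :=
  if v ≤ t.best - P.γ then
    if P.succTol ≤ t.succ + 1 then
      ⟨t.dim, t.count + 1, min t.best v, min (2 * t.len) P.lenMax, 0, 0⟩
    else ⟨t.dim, t.count + 1, min t.best v, t.len, t.succ + 1, 0⟩
  else
    if P.failTol t.dim ≤ t.fail + 1 then
      ⟨t.dim, t.count + 1, min t.best v, t.len / 2, 0, 0⟩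
    else ⟨t.dim, t.count + 1, min t.best v, t.len, 0, t.fail + 1⟩

/-- The summary after a possible split or restart. -/
def proceed (t : Summary) : Summary :=
  if P.lenMin < t.len then t
  else if t.dim < D then ⟨min (t.dim * (P.b + 1)) D, t.count, t.best, P.lenInit, 0, 0⟩
  else ⟨t.dim, 0, t.best, P.lenInit, 0, 0⟩

/-- The summary after an evaluation with value `v`. -/
def next (t : Summary) (v : ℝ) : Summary :=
  if t.count < P.nInit then t.record v else (t.adjust P v).proceed P

/-- The summary of the initial state. -/
def initial : Summary := ⟨P.dInit, 0, 0, P.lenInit, 0, 0⟩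

/-- The summary before the evaluation `k` when the observed values are `v`. -/
def run (v : ℕ → ℝ) : ℕ → Summary
  | 0 => initial P
  | k + 1 => (run v k).next P (v k)

/-! ### Measurability -/

/-- All components of a random summary are measurable. -/
structure IsMeasurable {Ω : Type*} [MeasurableSpace Ω] (t : Ω → Summary) : Prop where
  dim : Measurable fun ω => (t ω).dim
  count : Measurable fun ω => (t ω).count
  best : Measurable fun ω => (t ω).best
  len : Measurable fun ω => (t ω).len
  succ : Measurable fun ω => (t ω).succ
  fail : Measurable fun ω => (t ω).fail

section

variable {P} {Ω : Type*} {m : MeasurableSpace Ω} {t u : Ω → Summary} {v : Ω → ℝ}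

lemma IsMeasurable.ite {p : Ω → Prop} [DecidablePred p] (hp : MeasurableSet {ω | p ω})
    (ht : IsMeasurable t) (hu : IsMeasurable u) :
    IsMeasurable fun ω => if p ω then t ω else u ω where
  dim := by simpa only [apply_ite] using ht.dim.ite hp hu.dim
  count := by simpa only [apply_ite] using ht.count.ite hp hu.count
  best := by simpa only [apply_ite] using ht.best.ite hp hu.best
  len := by simpa only [apply_ite] using ht.len.ite hp hu.len
  succ := by simpa only [apply_ite] using ht.succ.ite hp hu.succ
  fail := by simpa only [apply_ite] using ht.fail.ite hp hu.fail

lemma IsMeasurable.record (ht : IsMeasurable t) (hv : Measurable v) :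
    IsMeasurable fun ω => (t ω).record (v ω) where
  dim := ht.dim
  count := ht.count.add_const 1
  best := hv.ite (ht.count (measurableSet_singleton 0)) (ht.best.min hv)
  len := ht.len
  succ := ht.succ
  fail := ht.fail

lemma IsMeasurable.adjust (ht : IsMeasurable t) (hv : Measurable v) :
    IsMeasurable fun ω => (t ω).adjust P (v ω) := by
  have hb := ht.best.min hv
  have hc := ht.count.add_const 1
  refine .ite (measurableSet_le hv (ht.best.sub_const _)) (.ite ?_ ?_ ?_) (.ite ?_ ?_ ?_)
  · exact measurableSet_le measurable_const (ht.succ.add_const 1)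
  · exact ⟨ht.dim, hc, hb, (ht.len.const_mul 2).min measurable_const, measurable_const,
      measurable_const⟩
  · exact ⟨ht.dim, hc, hb, ht.len, ht.succ.add_const 1, measurable_const⟩
  · exact measurableSet_le ((measurable_from_nat (f := P.failTol)).comp ht.dim)
      (ht.fail.add_const 1)
  · exact ⟨ht.dim, hc, hb, ht.len.div_const 2, measurable_const, measurable_const⟩
  · exact ⟨ht.dim, hc, hb, ht.len, measurable_const, ht.fail.add_const 1⟩

lemma IsMeasurable.proceed (ht : IsMeasurable t) :
    IsMeasurable fun ω => (t ω).proceed P := by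
  refine .ite (measurableSet_lt measurable_const ht.len) ht
    (.ite (measurableSet_lt ht.dim measurable_const) ?_ ?_)
  · exact ⟨(ht.dim.mul_const _).min measurable_const, ht.count, ht.best, measurable_const,
      measurable_const, measurable_const⟩
  · exact ⟨ht.dim, measurable_const, ht.best, measurable_const, measurable_const,
      measurable_const⟩

lemma IsMeasurable.next (ht : IsMeasurable t) (hv : Measurable v) :
    IsMeasurable fun ω => (t ω).next P (v ω) :=
  .ite (measurableSet_lt ht.count measurable_const) (ht.record hv) (ht.adjust hv).proceed

lemma IsMeasurable.measurableSet_eq (ht : IsMeasurable t) (d n : ℕ) :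
    MeasurableSet {ω | (t ω).dim = d ∧ (t ω).count = n} :=
  (ht.dim (measurableSet_singleton d)).inter (ht.count (measurableSet_singleton n))

/-- The summary before the evaluation `k` depends measurably on the values observed before. -/
lemma isMeasurable_run {v : ℕ → Ω → ℝ} {k : ℕ} (hv : ∀ j < k, Measurable (v j)) :
    IsMeasurable fun ω => run P (fun j => v j ω) k := by
  induction k with
  | zero => constructor <;> exact measurable_const
  | succ k ih => exact (ih fun j hj => hv j (by omega)).next (hv k (by omega))

end

/-! ### Recurrence of the restarts -/

/-- Bounds that hold throughout a run. -/
structure Valid (t : Summary) : Prop where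
  one_le_dim : 1 ≤ t.dim
  dim_le : t.dim ≤ D
  lenMin_lt : P.lenMin < t.len

variable {P}

/-- A side length that falls to `lenMin` or below is reset at once by a split or a restart. -/
lemma valid_next {t : Summary} (ht : t.Valid P) (v : ℝ) : (t.next P v).Valid P := by
  have h1 := ht.one_le_dim
  have h2 := ht.dim_le
  have h3 := ht.lenMin_lt
  have hadj : (t.adjust P v).dim = t.dim := by unfold adjust; split_ifs <;> rfl
  unfold next
  split_ifs
  · exact ⟨h1, h2, h3⟩
  · unfold proceed
    split_ifs with h4 h5
    · exact ⟨hadj ▸ h1, hadj ▸ h2, h4⟩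
    · refine ⟨le_min ?_ (h1.trans h2), min_le_right _ _, P.lenMin_lt⟩
      rw [hadj]
      exact Nat.mul_pos h1 (Nat.succ_pos _)
    · exact ⟨hadj ▸ h1, hadj ▸ h2, P.lenMin_lt⟩

lemma valid_run (v : ℕ → ℝ) (k : ℕ) : (run P v k).Valid P := by
  induction k with
  | zero => exact ⟨P.one_le_dInit, P.dInit_le, P.lenMin_lt⟩
  | succ k ih => exact valid_next ih _

variable (P) in
/-- A quantity that decreases lexicographically between restarts if all values exceed `-C`. -/
def potential (C : ℝ) (t : Summary) : ℕ ×ₗ ℕ ×ₗ ℕ ×ₗ ℕ ×ₗ ℕ :=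
  toLex (P.nInit - t.count, toLex (D - t.dim, toLex (⌊(t.best + C) / P.γ⌋₊,
    toLex (⌊t.len / P.lenMin⌋₊, P.failTol t.dim - t.fail))))

/-- Each kind of step lowers one component and raises none before it: initial points the first,
splits the second, successes the third, halvings the fourth (unless the third drops), other failures
the fifth (likewise). Expansions and resets only affect later components. -/
lemma potential_next_lt {t : Summary} (ht : t.Valid P) {C v : ℝ} (hv : -C < v)
    (hr : ¬((t.next P v).dim = D ∧ (t.next P v).count = 0)) :
    (t.next P v).potential P C < t.potential P C := by
  have hγ := P.γ_pos
  have hmin := P.lenMin_pos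
  by_cases hc : t.count < P.nInit
  · simp only [next, if_pos hc, potential, Prod.Lex.toLex_lt_toLex, record]
    left
    omega
  · have hcount : (t.adjust P v).count = t.count + 1 := by unfold adjust; split_ifs <;> rfl
    have hdim : (t.adjust P v).dim = t.dim := by unfold adjust; split_ifs <;> rfl
    have hle := ht.dim_le
    simp only [next, if_neg hc] at hr ⊢
    unfold proceed at hr ⊢
    split_ifs at hr ⊢ with h1 h2
    · have hn : P.nInit - (t.count + 1) = P.nInit - t.count := by omega
      have hbest : ⌊(min t.best v + C) / P.γ⌋₊ ≤ ⌊(t.best + C) / P.γ⌋₊ := by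
        gcongr
        exact min_le_left _ _
      simp only [potential, Prod.Lex.toLex_lt_toLex, hcount, hdim, hn, true_and, lt_irrefl,
        false_or]
      unfold adjust
      split_ifs with h3 h4 h5
      -- A success lowers `best` by at least `γ`, hence the floor by at least one; `-C < v` keeps
      -- the truncated floor positive before the step.
      iterate 2
        left
        change ⌊(min t.best v + C) / P.γ⌋₊ < _
        rw [min_eq_right (by linarith)]
        refine Nat.lt_of_succ_le (Nat.le_floor ?_)
        have := Nat.floor_le (div_nonneg (by linarith : 0 ≤ v + C) hγ.le)
        rw [Nat.cast_succ, le_div_iff₀ hγ]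
        rw [le_div_iff₀ hγ] at this
        linarith
      · refine hbest.lt_or_eq.imp id fun h => ⟨h, Or.inl ?_⟩
        change ⌊t.len / 2 / P.lenMin⌋₊ < ⌊t.len / P.lenMin⌋₊
        -- Halving a natural number, rounded down, is a strict decrease only if it is positive.
        have h6 : 1 ≤ ⌊t.len / P.lenMin⌋₊ := by
          refine Nat.le_floor ?_
          rw [Nat.cast_one, one_le_div hmin]
          exact ht.lenMin_lt.le
        rw [div_right_comm, ← Nat.cast_two (R := ℝ), Nat.floor_div_natCast]
        omega
      · refine hbest.lt_or_eq.imp id fun h => ⟨h, Or.inr ⟨rfl, ?_⟩⟩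
        change P.failTol t.dim - (t.fail + 1) < _
        omega
    · have hn : P.nInit - (t.count + 1) = P.nInit - t.count := by omega
      simp only [potential, Prod.Lex.toLex_lt_toLex, hcount, hn, hdim, true_and, lt_irrefl,
        false_or]
      left
      have h3 := ht.one_le_dim
      have h4 := P.one_le_b
      have h5 : t.dim * 2 ≤ t.dim * (P.b + 1) := Nat.mul_le_mul_left _ (by omega)
      omega
    · exact absurd ⟨by simp only [hdim] at h2 ⊢; omega, rfl⟩ hr

/-- There are restarts in the input dimension after every time. -/
lemma exists_restart_gt {v : ℕ → ℝ} {C : ℝ} (hv : ∀ k, -C < v k) (k : ℕ) :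
    ∃ k' > k, (run P v k').dim = D ∧ (run P v k').count = 0 := by
  induction h : (run P v k).potential P C using WellFoundedLT.induction generalizing k with
  | ind a ih =>
    subst h
    by_cases hr : (run P v (k + 1)).dim = D ∧ (run P v (k + 1)).count = 0
    · exact ⟨k + 1, Nat.lt_succ_self k, hr⟩
    · obtain ⟨k', hk', h⟩ := ih _ (potential_next_lt (valid_run v k) (hv k) hr) (k + 1) rfl
      exact ⟨k', by omega, h⟩

lemma count_run_add {v : ℕ → ℝ} {k i : ℕ} (hk : (run P v k).count = 0) (hi : i ≤ P.nInit) :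
    (run P v (k + i)).count = i := by
  induction i with
  | zero => exact hk
  | succ i ih =>
    have h := ih (by omega)
    rw [← add_assoc, run, next, if_pos (by omega), record, h]

/-- The initial points of a restart are evaluated before the next restart. -/
lemma add_nInit_le_of_restart {v : ℕ → ℝ} {k k' : ℕ} (hk : (run P v k).count = 0)
    (hk' : (run P v k').count = 0) (hlt : k < k') : k + P.nInit ≤ k' := by
  by_contra! h
  have := count_run_add hk (i := k' - k) (by omega)
  rw [Nat.add_sub_cancel' hlt.le] at this
  omega

end Summary

/-! ### States and their summaries -/

variable {D : ℕ} {P : Params D} {f : Pt D → ℝ}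

lemma lift_mem_cube {d : ℕ} {S : Matrix (Fin d) (Fin D) ℝ} (hS : IsSparseEmbedding S)
    {y : Pt d} (hy : y ∈ cube d) : lift S y ∈ cube D := by
  intro i
  obtain ⟨j, hj, huniq⟩ := hS.2 i
  have h : lift S y i = S j i * y j := by
    change ∑ j', S j' i * y j' = _
    refine Finset.sum_eq_single j (fun j' _ hne => ?_) (by simp)
    rw [not_not.mp fun h => hne (huniq j' h), zero_mul]
  obtain ⟨h1, h2⟩ := hy j
  rw [h]
  rcases hS.1 j i with h0 | h0 | h0
  · exact absurd h0 hj
  · rw [h0, one_mul]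
    exact ⟨h1, h2⟩
  · rw [h0]
    constructor <;> linarith

/-- `t` is the summary of the state `s`, whose embedding is sparse. -/
structure Summarizes (s : State D) (t : Summary) : Prop where
  emb : IsSparseEmbedding s.emb
  dim : t.dim = s.dim
  count : t.count = s.data.length
  le : ∀ q ∈ s.data, t.best ≤ q.2
  mem : s.data ≠ [] → ∃ q ∈ s.data, q.2 = t.best
  len : t.len = s.len
  succ : t.succ = s.succ
  fail : t.fail = s.fail

lemma Summarizes.initial {s : State D} (hs : IsInitial P s) :
    Summarizes s (Summary.initial P) := by
  obtain ⟨h1, h2, h3, h4, h5, h6⟩ := hs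
  constructor <;> simp_all [Summary.initial, h2.1]

lemma Summarizes.record {s : State D} {t : Summary} (h : Summarizes s t) (y : Pt s.dim) (v : ℝ) :
    Summarizes (record s y v) (t.record v) := by
  have hc : t.count = 0 ↔ s.data = [] := by rw [h.count, List.length_eq_zero_iff]
  refine ⟨h.emb, h.dim, ?_, ?_, ?_, h.len, h.succ, h.fail⟩
  · simp [Baxus.record, Summary.record, h.count]
  · intro q hq
    change (if t.count = 0 then v else min t.best v) ≤ q.2
    rcases List.mem_append.mp (show q ∈ s.data ++ [(y, v)] from hq) with hq | hq
    · rw [if_neg fun h0 => List.ne_nil_of_mem hq (hc.mp h0)]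
      exact (min_le_left _ _).trans (h.le q hq)
    · rw [List.mem_singleton.mp hq]
      split_ifs
      · exact le_rfl
      · exact min_le_right _ _
  · intro _
    change ∃ q ∈ s.data ++ [(y, v)], q.2 = if t.count = 0 then v else min t.best v
    have hlast : (y, v) ∈ s.data ++ [(y, v)] := by simp
    split_ifs with h0
    · exact ⟨_, hlast, rfl⟩
    · rcases min_choice t.best v with hm | hm
      · obtain ⟨q, hq, hq'⟩ := h.mem (mt hc.mpr h0)
        exact ⟨q, List.mem_append_left _ hq, hq'.trans hm.symm⟩
      · exact ⟨_, hlast, hm.symm⟩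

/-- Data must be present: over an empty list `Improves` holds vacuously, while `best` is a
placeholder. -/
lemma Summarizes.improves_iff {s : State D} {t : Summary} (h : Summarizes s t)
    (hs : s.data ≠ []) (v : ℝ) : Improves P s v ↔ v ≤ t.best - P.γ := by
  constructor
  · intro hi
    obtain ⟨q, hq, hq'⟩ := h.mem hs
    exact hq' ▸ hi q hq
  · intro hv q hq
    linarith [h.le q hq]

lemma Summarizes.adjust {s : State D} {t : Summary} (h : Summarizes s t)
    (hs : s.data ≠ []) (y : Pt s.dim) (v : ℝ) :
    Summarizes (adjust P s y v) (t.adjust P v) := by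
  -- The data change as for an initial point; only side length and counters differ.
  obtain ⟨h1, h2, h3, h4, h5, -, -, -⟩ := h.record y v
  have hc : t.count ≠ 0 := by rwa [h.count, Ne, List.length_eq_zero_iff]
  simp only [Summary.record, hc, if_false] at h2 h3 h4 h5
  unfold Baxus.adjust Summary.adjust
  simp only [h.improves_iff hs, h.succ, h.fail, h.len, h.dim]
  split_ifs
  all_goals exact ⟨h1, rfl, h3, h4, h5, rfl, rfl, rfl⟩

lemma Summarizes.proceed {s s' : State D} {t : Summary} (h : Summarizes s t)
    (hs : Continue P s s') : Summarizes s' (t.proceed P) := by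
  unfold Continue at hs
  unfold Summary.proceed
  simp only [h.len, h.dim]
  split_ifs at hs ⊢
  · exact hs ▸ h
  · obtain ⟨h1, ⟨parent, h2, h3⟩, h4, h5, h6⟩ := hs
    refine ⟨h2.1, h1.symm, by simp [h3, h.count], ?_, ?_, h4.symm, h5.symm, h6.symm⟩
    · intro q hq
      rw [h3, List.mem_map] at hq
      obtain ⟨q', hq', rfl⟩ := hq
      exact h.le q' hq'
    · intro h0
      rw [h3] at h0 ⊢
      obtain ⟨q, hq, hq'⟩ := h.mem fun h7 => h0 (by rw [h7, List.map_nil])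
      exact ⟨_, List.mem_map_of_mem hq, hq'⟩
  · subst hs
    exact ⟨h.emb, rfl, rfl, fun _ hq => absurd hq List.not_mem_nil, fun h0 => absurd rfl h0,
      rfl, rfl, rfl⟩

lemma Summarizes.next {s s' : State D} {t : Summary} {x : Pt D} (h : Summarizes s t)
    (hs : Step P f s x s') : x ∈ cube D ∧ Summarizes s' (t.next P (f x)) := by
  obtain ⟨y, hy, hx, hs⟩ := hs
  refine ⟨hx ▸ lift_mem_cube h.emb hy, ?_⟩
  unfold Summary.next
  rw [h.count]
  split_ifs at hs ⊢ with hc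
  · exact hs ▸ h.record y (f x)
  · refine (h.adjust ?_ y (f x)).proceed hs.2
    intro h0
    have := P.one_le_nInit
    rw [h0, List.length_nil] at hc
    omega

/-! ### Almost sure hitting of balls -/

section Run

lemma measurable_history {Ω : Type*} {x : ℕ → Ω → Pt D} {j k : ℕ} (hjk : j < k) : Measurable[history x k] (x j) :=
  (comap_measurable (x j)).mono
    (le_iSup₂ (f := fun j (_ : j < k) => MeasurableSpace.comap (x j) inferInstance) j hjk) le_rfl

variable {Ω : Type*} [MeasurableSpace Ω] {state : ℕ → Ω → State D} {x : ℕ → Ω → Pt D}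

lemma IsRun.summarizes (h : IsRun P f state x) (k : ℕ) (ω : Ω) :
    Summarizes (state k ω) (Summary.run P (fun j => f (x j ω)) k) := by
  induction k with
  | zero => exact .initial (h.initial ω)
  | succ k ih => exact (ih.next (h.step k ω)).2

lemma IsRun.mem_cube (h : IsRun P f state x) (k : ℕ) (ω : Ω) : x k ω ∈ cube D :=
  ((h.summarizes k ω).next (h.step k ω)).1

lemma IsRun.mem_restartAt_iff (h : IsRun P f state x) {k : ℕ} {ω : Ω} :
    ω ∈ restartAt state k ↔ 0 < k ∧ (Summary.run P (fun j => f (x j ω)) k).dim = D ∧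
      (Summary.run P (fun j => f (x j ω)) k).count = 0 := by
  rw [(h.summarizes k ω).dim, (h.summarizes k ω).count, List.length_eq_zero_iff]
  rfl

lemma IsRun.history_le (h : IsRun P f state x) (k : ℕ) :
    history x k ≤ (inferInstance : MeasurableSpace Ω) :=
  iSup₂_le fun j _ => (h.measurable j).comap_le

/-- Nothing is assumed on the measurability of `state`; the restart is read off the summary instead.
-/
lemma IsRun.measurableSet_restartAt (h : IsRun P f state x)
    (hf : Measurable ((cube D).domRestrict f)) (k : ℕ) :
    MeasurableSet[history x k] (restartAt state k) := by
  -- `f` is measurable only on the box, so the points are first viewed in the subtype.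
  have hv : ∀ j < k, Measurable[history x k] fun ω => f (x j ω) := fun j hj =>
    hf.comp ((measurable_history hj).subtype_mk (h := h.mem_cube j))
  have hm := Summary.isMeasurable_run (P := P) hv
  have : restartAt state k = {ω | 0 < k ∧ (Summary.run P (fun j => f (x j ω)) k).dim = D ∧
      (Summary.run P (fun j => f (x j ω)) k).count = 0} := by
    ext ω
    exact h.mem_restartAt_iff
  rw [this]
  exact .inter (.const _) (hm.measurableSet_eq D 0)

/-- Almost surely, some evaluated point lies in a given ball with its center in the box. -/
theorem IsRun.ae_exists_mem_closedBall (h : IsRun P f state x)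
    (hf : Measurable ((cube D).domRestrict f)) {C : ℝ} (hC : ∀ x ∈ cube D, |f x| < C)
    {μ : Measure Ω} [IsProbabilityMeasure μ] (hhit : RestartsHitBalls P μ state x)
    {p : Pt D} (hp : p ∈ cube D) {δ : ℝ} (hδ : 0 < δ) :
    ∀ᵐ ω ∂μ, ∃ k, ‖p - x k ω‖ ≤ δ := by
  obtain ⟨ν, hν, hhit⟩ := hhit p hp δ hδ
  set G : ℕ → Set Ω := fun k => restartAt state k ∩ ⋂ j, ⋂ _ : j < k, {ω | ‖p - x j ω‖ ≤ δ}ᶜ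
    with hG
  set H : ℕ → Set Ω := fun k => G k ∩ {ω | ∃ i < P.nInit, ‖p - x (k + i) ω‖ ≤ δ} with hH
  have hball : MeasurableSet {z : Pt D | ‖p - z‖ ≤ δ} :=
    measurableSet_le (by fun_prop) measurable_const
  have hGm : ∀ k, MeasurableSet[history x k] (G k) := fun k =>
    (h.measurableSet_restartAt hf k).inter <| .iInter fun j => .iInter fun hj =>
      (measurable_history hj hball).compl
  have hHm : ∀ k, MeasurableSet (H k) := by
    intro k
    refine (h.history_le k _ (hGm k)).inter ?_
    simp only [← exists_prop, Set.ofPred_exists]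
    exact .iUnion fun i => .iUnion fun _ => h.measurable (k + i) hball
  have hdisj : Pairwise (Function.onFun Disjoint H) := by
    refine (pairwise_disjoint_on H).mpr fun k k' hlt => ?_
    refine Set.disjoint_left.mpr fun ω hk hk' => ?_
    obtain ⟨⟨hr, -⟩, i, hi, hi'⟩ := hk
    obtain ⟨⟨hr', hno⟩, -⟩ := hk'
    have := Summary.add_nInit_le_of_restart (h.mem_restartAt_iff.mp hr).2.2
      (h.mem_restartAt_iff.mp hr').2.2 hlt
    -- The hit at `k + i` comes before `k'`, which `G k'` forbids.
    exact Set.mem_iInter₂.mp hno (k + i) (by omega) hi'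
  have hsum : ENNReal.ofReal ν * ∑' k, μ (G k) ≤ 1 := by
    rw [← ENNReal.tsum_mul_left]
    calc ∑' k, ENNReal.ofReal ν * μ (G k) ≤ ∑' k, μ (H k) :=
          ENNReal.tsum_le_tsum fun k => hhit k (G k) (hGm k) Set.inter_subset_left
      _ = μ (⋃ k, H k) := (measure_iUnion hdisj hHm).symm
      _ ≤ 1 := prob_le_one
  have hfin : ∑' k, μ (G k) ≠ ⊤ := by
    intro htop
    rw [htop, ENNReal.mul_top (by simpa using hν)] at hsum
    simp at hsum
  filter_upwards [ae_eventually_notMem hfin] with ω hω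
  by_contra! hno
  obtain ⟨N, hN⟩ := eventually_atTop.mp hω
  obtain ⟨k, hk, hr⟩ := Summary.exists_restart_gt (P := P)
    (fun j => (abs_lt.mp (hC _ (h.mem_cube j ω))).1) N
  -- Without any hit, every restart after `N` lies in `G`.
  refine hN k hk.le ⟨h.mem_restartAt_iff.mpr ⟨by omega, hr⟩, ?_⟩
  exact Set.mem_iInter₂.mpr fun j _ => not_le.mpr (hno j)

end Run

/-! ### Almost minimal balls and convergence -/

/-- Near a point of a region of continuity there are balls on which `f` is almost minimal. -/
lemma InContinuousRegion.exists_closedBall {p : Pt D} (hp : InContinuousRegion f p) {ε : ℝ}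
    (hε : 0 < ε) : ∃ q ∈ cube D, ∃ δ > 0, ∀ z, ‖q - z‖ ≤ δ → f z < f p + ε := by
  obtain ⟨R, hR, hpR, hcl, -, hcont⟩ := hp
  obtain ⟨η, hη, hη'⟩ := Metric.continuousOn_iff.mp hcont p hpR ε hε
  -- The minimizer `p` may be a boundary point of `R`, so the ball is centred at a nearby interior
  -- point.
  obtain ⟨q, hq, hpq⟩ := Metric.mem_closure_iff.mp (hcl hpR) η hη
  have hU : interior R ∩ Metric.ball p η ∈ 𝓝 q :=
    (isOpen_interior.inter Metric.isOpen_ball).mem_nhds ⟨hq, by rwa [Metric.mem_ball']⟩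
  obtain ⟨δ, hδ, hball⟩ := Metric.nhds_basis_closedBall.mem_iff.mp hU
  refine ⟨q, hR (interior_subset hq), δ, hδ, fun z hz => ?_⟩
  obtain ⟨h1, h2⟩ := hball (by rwa [Metric.mem_closedBall', dist_eq_norm])
  have := hη' z (interior_subset h1) h2
  rw [Real.dist_eq] at this
  linarith [(abs_lt.mp this).2]

end

end Baxus

theorem mainTheorem4 {D : ℕ} (P : Baxus.Params D) (f : Baxus.Pt D → ℝ)
    (hf_meas : Measurable ((Baxus.cube D).domRestrict f))
    (hf_sparse : Baxus.IsSparse f)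
    (hf_bdd : ∃ C : ℝ, 0 < C ∧ ∀ x ∈ Baxus.cube D, |f x| < C)
    (hf_region : ∃ x : Baxus.Pt D, Baxus.IsMinimizer f x ∧ Baxus.InContinuousRegion f x)
    {Ω : Type*} [MeasurableSpace Ω] (μ : Measure Ω) [IsProbabilityMeasure μ]
    (state : ℕ → Ω → Baxus.State D) (x : ℕ → Ω → Baxus.Pt D)
    (hrun : Baxus.IsRun P f state x)
    (hhit : Baxus.RestartsHitBalls P μ state x)
    (xbest : ℕ → Ω → Baxus.Pt D) (hbest : Baxus.IsBestSoFar f x xbest)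
    (xstar : Baxus.Pt D) (hstar : Baxus.IsMinimizer f xstar) :
    ∀ᵐ ω ∂μ, Tendsto (fun k => f (xbest k ω)) atTop (𝓝 (f xstar)) := by
  obtain ⟨C, -, hC⟩ := hf_bdd
  obtain ⟨p, hp, hreg⟩ := hf_region
  have hle : ∀ k ω, f xstar ≤ f (xbest k ω) := by
    intro k ω
    obtain ⟨j, -, hj⟩ := (hbest k ω).1
    exact hj ▸ hstar.2 _ (hrun.mem_cube j ω)
  have key : ∀ n : ℕ, ∀ᵐ ω ∂μ, ∃ k, f (x k ω) < f xstar + 1 / (n + 1) := by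
    intro n
    obtain ⟨q, hq, δ, hδ, hball⟩ := hreg.exists_closedBall (Nat.one_div_pos_of_nat (n := n))
    filter_upwards [hrun.ae_exists_mem_closedBall hf_meas hC hhit hq hδ] with ω ⟨k, hk⟩
    exact ⟨k, (hball _ hk).trans_le (add_le_add_left (hp.2 _ hstar.1) _)⟩
  filter_upwards [ae_all_iff.mpr key] with ω hω
  refine tendsto_order.mpr ⟨fun a ha => .of_forall fun k => ha.trans_le (hle k ω), fun a ha => ?_⟩
  obtain ⟨n, hn⟩ := exists_nat_one_div_lt (sub_pos.mpr ha)
  obtain ⟨j, hj⟩ := hω n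
  filter_upwards [eventually_ge_atTop j] with k hk
  linarith [(hbest k ω).2 j hk]
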